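/- Let $\mathcal H$ be the $3\times 3$ grid graph, with vertex set $V=\{1,2,3\}^2$, two vertices being adjacent when they agree in one coordinate and differ by exactly $1$ in the other. The centered Gaussian graphical model on $\mathcal H$ is the family of distributions $\mathcal N(0,\Sigma)$ on $\mathbb R^{V}$ with $\Sigma$ positive definite and $(\Sigma^{-1})_{ij}=0$ for all distinct non-adjacent $i,j\in V$. Given observations $x_1,\dots,x_n\in\mathbb R^V$, $n\ge 1$, the maximum likelihood estimator (MLE) is said to exist if the likelihood $\Sigma\mapsto\prod_{k=1}^n(2\pi)^{-9/2}(\det\Sigma)^{-1/2}\exp\bigl(-\tfrac12x_k^T\Sigma^{-1}x_k\bigr)$ attains its maximum over the covariance matrices $\Sigma$ of the model. If $n\ge 3$ and $X_1,\dots,X_n$ are independent draws from any distribution $\mathcal N(0,\Sigma)$ in the model, then the MLE exists with probability one. If $n<2$, that is, for $n=1$ observation, the MLE does not exist, whatever the observed vector is. -/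

import Mathlib

namespace GaussianGraphicalModel

open MeasureTheory ProbabilityTheory Matrix

/-- The set of covariance matrices of the (centered) Gaussian graphical model on `G`: positive
definite `Σ` with `(Σ⁻¹)ᵢⱼ = 0` for all distinct non-adjacent `i, j`. (The self-loops, which are
implicitly part of the graph, are accounted for by `i ≠ j`.) -/
def model {V : Type*} [Fintype V] [DecidableEq V] (G : SimpleGraph V) : Set (Matrix V V ℝ) :=
  {S | S.PosDef ∧ ∀ i j : V, i ≠ j → ¬ G.Adj i j → S⁻¹ i j = 0}

/-- The Lebesgue density of `N(0, S)` at `x`, for positive definite `S`: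
`(2π)^{-m/2} (det S)^{-1/2} exp(-xᵀ S⁻¹ x / 2)`, where `m` is the number of coordinates. -/
noncomputable def gaussianDensity {V : Type*} [Fintype V] [DecidableEq V]
    (S : Matrix V V ℝ) (x : EuclideanSpace ℝ V) : ℝ :=
  (Real.sqrt ((2 * Real.pi) ^ Fintype.card V * S.det))⁻¹ *
    Real.exp (-(x.ofLp ⬝ᵥ (S⁻¹ *ᵥ x.ofLp)) / 2)

/-- The likelihood of `S` given the observations `x₁, …, xₙ` drawn independently
from `N(0, S)`. -/
noncomputable def likelihood {V : Type*} [Fintype V] [DecidableEq V] {n : ℕ}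
    (x : Fin n → EuclideanSpace ℝ V) (S : Matrix V V ℝ) : ℝ :=
  ∏ k, gaussianDensity S (x k)

/-- `S` is a maximum likelihood estimate of the covariance matrix for the data `x` in the Gaussian
graphical model on `G`: it lies in the model and maximizes the likelihood over the model. -/
def IsMLE {V : Type*} [Fintype V] [DecidableEq V] (G : SimpleGraph V) {n : ℕ}
    (x : Fin n → EuclideanSpace ℝ V) (S : Matrix V V ℝ) : Prop :=
  S ∈ model G ∧ IsMaxOn (likelihood x) (model G) S

/-- The MLE exists for the data `x`: the likelihood attains its maximum over the model. -/
def MLEExists {V : Type*} [Fintype V] [DecidableEq V] (G : SimpleGraph V) {n : ℕ}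
    (x : Fin n → EuclideanSpace ℝ V) : Prop :=
  ∃ S : Matrix V V ℝ, IsMLE G x S

/-- The `3 × 3` grid: nine vertices `(i, j)`, two of them adjacent when they agree in one
coordinate and are consecutive in the other. -/
def grid33 : SimpleGraph (Fin 3 × Fin 3) :=
  SimpleGraph.boxProd (SimpleGraph.pathGraph 3) (SimpleGraph.pathGraph 3)

end GaussianGraphicalModel

/-! In terms of `K = S⁻¹`, the squared likelihood is a constant times `det K ^ n * exp (-∑ xₖᵀ K
xₖ)`. If no nonzero `K` in the closed cone of positive semidefinite matrices supported on the graph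
kills all data, this function decays at infinity along the cone and, for `n ≥ 1`, vanishes where `K`
is singular, so it has a positive definite maximizer (`mleExists_of_forall_eq_zero`). If instead `v
vᵀ` is nonzero, supported on the graph and kills the data, adding it to `K` raises the determinant
at no cost (`not_mleExists_of_dotProduct_eq_zero`).

Almost surely three samples are independent on any three coordinates, so a row of `K` with at most
three possible nonzero entries is zero; this eliminates the grid row by row
(`eq_zero_of_mulVec_eq_zero`). One sample is always orthogonal to some nonzero `v` supported on an
edge. -/

namespace GaussianGraphicalModel
open MeasureTheory ProbabilityTheory Matrix

/-! ### Gaussian samples in general position -/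

/-- A hyperplane through the mean is a null set of a nondegenerate Gaussian measure. -/
theorem ae_inner_ne_zero {V : Type*} [Fintype V] [DecidableEq V] {S : Matrix V V ℝ}
    (hS : S.PosDef) {w : EuclideanSpace ℝ V} (hw : w ≠ 0) :
    ∀ᵐ y ∂multivariateGaussian 0 S, inner ℝ w y ≠ 0 := by
  have hmap := IsGaussian.map_eq_gaussianReal (μ := multivariateGaussian 0 S) (innerSL ℝ w)
  have hvar : Var[innerSL ℝ w; multivariateGaussian 0 S] = w.ofLp ⬝ᵥ S *ᵥ w.ofLp := by
    rw [← covarianceBilin_multivariateGaussian (μ := 0) hS.posSemidef,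
      covarianceBilin_self IsGaussian.memLp_two_id]
    rfl
  have hpos : 0 < w.ofLp ⬝ᵥ S *ᵥ w.ofLp := by
    have := hS.dotProduct_mulVec_pos (x := w.ofLp) (by simpa using hw)
    simpa using this
  have hne : Var[innerSL ℝ w; multivariateGaussian 0 S].toNNReal ≠ 0 := by
    rw [hvar]; simpa using hpos
  have hna := nullSingletonClass_gaussianReal
    (μ := ∫ x, innerSL ℝ w x ∂multivariateGaussian 0 S) hne
  rw [← hmap] at hna
  have h0 : ∀ᵐ t ∂(multivariateGaussian 0 S).map (innerSL ℝ w), t ≠ 0 := by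
    rw [ae_iff]
    simpa only [not_not, Set.ofPred_eq_eq_singleton] using hna.measure_singleton 0
  exact ae_of_ae_map (f := innerSL ℝ w) (by fun_prop) h0

/-- Independence makes the joint law a product, so Fubini reduces to a fixed nonzero `U`. -/
theorem ae_inner_ne_zero_of_indepFun {V Ω : Type*} [Fintype V] [DecidableEq V]
    [MeasurableSpace Ω] {P : Measure Ω} [IsProbabilityMeasure P] {S : Matrix V V ℝ}
    (hS : S.PosDef) {U Y : Ω → EuclideanSpace ℝ V} (hU : AEMeasurable U P)
    (hY : HasLaw Y (multivariateGaussian 0 S) P) (hUY : IndepFun U Y P)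
    (hne : ∀ᵐ ω ∂P, U ω ≠ 0) : ∀ᵐ ω ∂P, inner ℝ (U ω) (Y ω) ≠ 0 := by
  have hprod := (indepFun_iff_map_prod_eq_prod_map_map hU hY.aemeasurable).1 hUY
  have hset : MeasurableSet {p : EuclideanSpace ℝ V × EuclideanSpace ℝ V | inner ℝ p.1 p.2 ≠ 0} := by
    measurability
  have : ∀ᵐ p ∂P.map (fun ω => (U ω, Y ω)), inner ℝ p.1 p.2 ≠ 0 := by
    have := Measure.isProbabilityMeasure_map (μ := P) hU
    rw [hprod, hY.map_eq, Measure.ae_prod_iff_ae_ae hset]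
    have h1 : ∀ᵐ u ∂P.map U, u ≠ 0 :=
      (ae_map_iff hU (measurableSet_singleton 0).compl).2 hne
    filter_upwards [h1] with u hu using ae_inner_ne_zero hS hu
  exact ae_of_ae_map (hU.prodMk hY.aemeasurable) this

/-- The determinant of the coordinates `a, b, c` of the vectors `p, q, r`. -/
def coordDet {V : Type*} (p q r : V → ℝ) (a b c : V) : ℝ :=
  (p b * q c - p c * q b) * r a + (p c * q a - p a * q c) * r b + (p a * q b - p b * q a) * r c

theorem ae_coordDet_ne_zero {V Ω : Type*} [Fintype V] [DecidableEq V]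
    [MeasurableSpace Ω] {P : Measure Ω} [IsProbabilityMeasure P] {S : Matrix V V ℝ}
    (hS : S.PosDef) {n : ℕ} {X : Fin n → Ω → EuclideanSpace ℝ V}
    (hX : ∀ k, HasLaw (X k) (multivariateGaussian 0 S) P) (hind : iIndepFun X P)
    {i j k : Fin n} (hij : i ≠ j) (hik : i ≠ k) (hjk : j ≠ k)
    {a b c : V} (hab : a ≠ b) (hac : a ≠ c) (hbc : b ≠ c) :
    ∀ᵐ ω ∂P, coordDet (X i ω) (X j ω) (X k ω) a b c ≠ 0 := by
  have hm := fun k => (hX k).aemeasurable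
  -- The minors of size 1, 2, 3 are treated in turn: each is the inner product of a fresh sample
  -- with a cofactor vector, nonzero because the previous minor is one of its entries.
  have hi : ∀ᵐ ω ∂P, X i ω a ≠ 0 := by
    have h := ae_inner_ne_zero (w := EuclideanSpace.single a 1) hS (by simp)
    rw [← (hX i).map_eq] at h
    filter_upwards [ae_of_ae_map (hm i) h] with ω hω
    simpa [EuclideanSpace.inner_single_left] using hω
  let f : EuclideanSpace ℝ V → EuclideanSpace ℝ V := fun p =>
    p a • EuclideanSpace.single b 1 - p b • EuclideanSpace.single a 1
  have hf : Measurable f := by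
    exact Continuous.measurable (by fun_prop)
  have hj : ∀ᵐ ω ∂P, X i ω a * X j ω b - X i ω b * X j ω a ≠ 0 := by
    have h := ae_inner_ne_zero_of_indepFun hS (hf.comp_aemeasurable (hm i)) (hX j)
      ((hind.indepFun hij).comp hf measurable_id) ?_
    · filter_upwards [h] with ω hω
      simpa [f, inner_sub_left, inner_smul_left, EuclideanSpace.inner_single_left, mul_comm] using hω
    · filter_upwards [hi] with ω hω h0
      have := congrArg (fun v : EuclideanSpace ℝ V => v b) h0
      simp [f, hab.symm] at this
      exact hω this
  let g : EuclideanSpace ℝ V × EuclideanSpace ℝ V → EuclideanSpace ℝ V := fun p =>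
    (p.1 b * p.2 c - p.1 c * p.2 b) • EuclideanSpace.single a 1 +
    (p.1 c * p.2 a - p.1 a * p.2 c) • EuclideanSpace.single b 1 +
    (p.1 a * p.2 b - p.1 b * p.2 a) • EuclideanSpace.single c 1
  have hg : Measurable g := by
    exact Continuous.measurable (by fun_prop)
  have h := ae_inner_ne_zero_of_indepFun hS (hg.comp_aemeasurable ((hm i).prodMk (hm j))) (hX k)
      ((hind.indepFun_prodMk₀ hm i j k hik hjk).comp hg measurable_id) ?_
  · filter_upwards [h] with ω hω
    simpa [g, coordDet, inner_add_left, inner_smul_left, EuclideanSpace.inner_single_left, mul_comm] using hω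
  · filter_upwards [hj] with ω hω h0
    have := congrArg (fun v : EuclideanSpace ℝ V => v c) h0
    simp [g, hac.symm, hbc.symm] at this
    exact hω this

/-! ### Row elimination on the grid -/

/-- A row supported on three coordinates which is orthogonal to three vectors with nonvanishing
determinant in these coordinates is zero. -/
theorem eq_zero_of_coordDet_ne_zero {V : Type*} [Fintype V] [DecidableEq V]
    {p q r t : V → ℝ} {a b c : V} (hab : a ≠ b) (hac : a ≠ c) (hbc : b ≠ c)
    (hdet : coordDet p q r a b c ≠ 0) (ht : ∀ v, v ≠ a → v ≠ b → v ≠ c → t v = 0)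
    (hp : t ⬝ᵥ p = 0) (hq : t ⬝ᵥ q = 0) (hr : t ⬝ᵥ r = 0) : t = 0 := by
  have key : ∀ s : V → ℝ, t ⬝ᵥ s = t a * s a + t b * s b + t c * s c := by
    intro s
    rw [dotProduct, ← Finset.sum_subset (Finset.subset_univ {a, b, c})]
    · rw [Finset.sum_insert (by simp [hab, hac]), Finset.sum_pair hbc, add_assoc]
    · intro v _ hv
      simp only [Finset.mem_insert, Finset.mem_singleton, not_or] at hv
      rw [ht v hv.1 hv.2.1 hv.2.2, zero_mul]
  rw [key] at hp hq hr
  -- Cramer's rule: the coefficients are the cofactors of the column being solved for.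
  have ha : t a = 0 := by
    refine (mul_eq_zero.1 ?_).resolve_right hdet
    unfold coordDet
    linear_combination (q b * r c - q c * r b) * hp + (r b * p c - r c * p b) * hq
      + (p b * q c - p c * q b) * hr
  have hb : t b = 0 := by
    refine (mul_eq_zero.1 ?_).resolve_right hdet
    unfold coordDet
    linear_combination (q c * r a - q a * r c) * hp + (r c * p a - r a * p c) * hq
      + (p c * q a - p a * q c) * hr
  have hc : t c = 0 := by
    refine (mul_eq_zero.1 ?_).resolve_right hdet
    unfold coordDet
    linear_combination (q a * r b - q b * r a) * hp + (r a * p b - r b * p a) * hq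
      + (p a * q b - p b * q a) * hr
  funext v
  by_cases h1 : v = a
  · rw [h1, ha, Pi.zero_apply]
  by_cases h2 : v = b
  · rw [h2, hb, Pi.zero_apply]
  by_cases h3 : v = c
  · rw [h3, hc, Pi.zero_apply]
  exact ht v h1 h2 h3

instance instDecidableRelGrid33Adj : DecidableRel grid33.Adj := fun a b =>
  decidable_of_iff (((a.1.val + 1 = b.1.val ∨ b.1.val + 1 = a.1.val) ∧ a.2 = b.2) ∨
    ((a.2.val + 1 = b.2.val ∨ b.2.val + 1 = a.2.val) ∧ a.1 = b.1)) (by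
    simp [grid33, SimpleGraph.boxProd_adj, SimpleGraph.pathGraph_adj])

/-- A symmetric matrix supported on the grid that annihilates three vectors in general position
vanishes: its rows are killed first at the corners, then at the edge midpoints, then at the
centre. -/
theorem eq_zero_of_mulVec_eq_zero {K : Matrix (Fin 3 × Fin 3) (Fin 3 × Fin 3) ℝ}
    (hK : K.IsSymm) (hsupp : ∀ i j, i ≠ j → ¬ grid33.Adj i j → K i j = 0)
    {p q r : Fin 3 × Fin 3 → ℝ}
    (hdet : ∀ a b c, a ≠ b → a ≠ c → b ≠ c → coordDet p q r a b c ≠ 0)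
    (hp : K *ᵥ p = 0) (hq : K *ᵥ q = 0) (hr : K *ᵥ r = 0) : K = 0 := by
  have row : ∀ i a b c, a ≠ b → a ≠ c → b ≠ c →
      (∀ v, v ≠ a → v ≠ b → v ≠ c → K i v = 0) → ∀ v, K i v = 0 := by
    intro i a b c hab hac hbc ht
    exact congrFun (eq_zero_of_coordDet_ne_zero hab hac hbc (hdet a b c hab hac hbc) ht
      (congrFun hp i) (congrFun hq i) (congrFun hr i))
  have corner : ∀ i a b, i ≠ a → i ≠ b → a ≠ b →
      (∀ v, v ≠ i → v ≠ a → v ≠ b → ¬ grid33.Adj i v) → ∀ v, K i v = 0 :=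
    fun i a b hia hib hab h => row i i a b hia hib hab
      fun v h1 h2 h3 => hsupp i v h1.symm (h v h1 h2 h3)
  have h00 := corner (0, 0) (0, 1) (1, 0) (by decide) (by decide) (by decide) (by decide)
  have h02 := corner (0, 2) (0, 1) (1, 2) (by decide) (by decide) (by decide) (by decide)
  have h20 := corner (2, 0) (2, 1) (1, 0) (by decide) (by decide) (by decide) (by decide)
  have h22 := corner (2, 2) (2, 1) (1, 2) (by decide) (by decide) (by decide) (by decide)
  have mid : ∀ i, i ≠ (1, 1) → i ≠ (0, 0) →
      (∀ v, v ≠ i → v ≠ (1, 1) → grid33.Adj i v →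
        v = (0, 0) ∨ v = (0, 2) ∨ v = (2, 0) ∨ v = (2, 2)) → ∀ v, K i v = 0 := by
    intro i h1 h2 h
    -- The corner entries vanish by symmetry, leaving `i` and the centre; `(0, 0)` only pads the
    -- triple.
    refine row i i (1, 1) (0, 0) h1 h2 (by decide) fun v hv1 hv2 _ => ?_
    by_cases hadj : grid33.Adj i v
    · rw [← hK.apply]
      rcases h v hv1 hv2 hadj with rfl | rfl | rfl | rfl
      exacts [h00 _, h02 _, h20 _, h22 _]
    · exact hsupp i v hv1.symm hadj
  have h01 := mid (0, 1) (by decide) (by decide) (by decide)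
  have h10 := mid (1, 0) (by decide) (by decide) (by decide)
  have h12 := mid (1, 2) (by decide) (by decide) (by decide)
  have h21 := mid (2, 1) (by decide) (by decide) (by decide)
  have h11 : ∀ v, K (1, 1) v = 0 := by
    refine row (1, 1) (1, 1) (0, 0) (0, 1) (by decide) (by decide) (by decide) fun v hv _ _ => ?_
    rw [← hK.apply]
    obtain ⟨i, j⟩ := v
    fin_cases i <;> fin_cases j
    exacts [h00 _, h01 _, h02 _, h10 _, absurd rfl hv, h12 _, h20 _, h21 _, h22 _]
  ext ⟨i, j⟩ v
  fin_cases i <;> fin_cases j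
  exacts [h00 _, h01 _, h02 _, h10 _, h11 _, h12 _, h20 _, h21 _, h22 _]


/-! ### Existence and nonexistence of the maximum -/

/-- The closed cone of positive semidefinite matrices supported on `G`. -/
def concentrationCone {V : Type*} [Fintype V] (G : SimpleGraph V) : Set (Matrix V V ℝ) :=
  {K | K.PosSemidef ∧ ∀ i j : V, i ≠ j → ¬ G.Adj i j → K i j = 0}

/-- The sum of the values of the quadratic form `K` at the observations. -/
def dataForm {V : Type*} [Fintype V] {n : ℕ} (x : Fin n → EuclideanSpace ℝ V)
    (K : Matrix V V ℝ) : ℝ :=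
  ∑ k, (x k).ofLp ⬝ᵥ (K *ᵥ (x k).ofLp)

/-- The square of the likelihood as a function of the concentration matrix, up to a constant
factor. -/
noncomputable def concentrationLikelihood {V : Type*} [Fintype V] [DecidableEq V] {n : ℕ}
    (x : Fin n → EuclideanSpace ℝ V) (K : Matrix V V ℝ) : ℝ :=
  K.det ^ n * Real.exp (-dataForm x K)

section

variable {V : Type*} [Fintype V]

theorem isClosed_concentrationCone (G : SimpleGraph V) : IsClosed (concentrationCone G) := by
  have : concentrationCone G = {K : Matrix V V ℝ | K.IsHermitian} ∩
      ((⋂ v : V → ℝ, {K | 0 ≤ star v ⬝ᵥ (K *ᵥ v)}) ∩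
      ⋂ i, ⋂ j, ⋂ (_ : i ≠ j), ⋂ (_ : ¬ G.Adj i j), {K | K i j = 0}) := by
    ext K
    simp [concentrationCone, posSemidef_iff_dotProduct_mulVec, and_assoc]
  rw [this]
  refine (isClosed_eq (by fun_prop) (by fun_prop)).inter (IsClosed.inter ?_ ?_)
  · exact isClosed_iInter fun v => isClosed_le continuous_const (by fun_prop)
  · exact isClosed_iInter fun i => isClosed_iInter fun j => isClosed_iInter fun _ =>
      isClosed_iInter fun _ => isClosed_eq (by fun_prop) continuous_const

theorem smul_mem_concentrationCone {G : SimpleGraph V} {K : Matrix V V ℝ}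
    (hK : K ∈ concentrationCone G) {t : ℝ} (ht : 0 ≤ t) : t • K ∈ concentrationCone G :=
  ⟨hK.1.smul ht, fun i j hij h => by simp [hK.2 i j hij h]⟩

variable {n : ℕ} (x : Fin n → EuclideanSpace ℝ V)

theorem continuous_dataForm : Continuous (dataForm x) := by
  unfold dataForm
  fun_prop

theorem dataForm_smul (t : ℝ) (K : Matrix V V ℝ) : dataForm x (t • K) = t * dataForm x K := by
  simp [dataForm, Finset.mul_sum, smul_mulVec]

variable {x} in
theorem dataForm_pos {G : SimpleGraph V}
    (h : ∀ K ∈ concentrationCone G, (∀ k, K *ᵥ (x k).ofLp = 0) → K = 0)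
    {K : Matrix V V ℝ} (hK : K ∈ concentrationCone G) (h0 : K ≠ 0) : 0 < dataForm x K := by
  have hnn : ∀ k ∈ Finset.univ, 0 ≤ (x k).ofLp ⬝ᵥ (K *ᵥ (x k).ofLp) := fun k _ => by
    simpa using hK.1.dotProduct_mulVec_nonneg (x k).ofLp
  refine (Finset.sum_nonneg hnn).lt_of_ne' fun hz => h0 (h K hK fun k => ?_)
  have := (Finset.sum_eq_zero_iff_of_nonneg hnn).1 hz k (Finset.mem_univ k)
  exact (hK.1.dotProduct_mulVec_zero_iff _).1 (by simpa using this)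

variable [DecidableEq V]

theorem continuous_concentrationLikelihood : Continuous (concentrationLikelihood x) := by
  have := continuous_dataForm x
  unfold concentrationLikelihood
  fun_prop

theorem concentrationLikelihood_pos {K : Matrix V V ℝ} (hK : K.PosDef) :
    0 < concentrationLikelihood x K :=
  mul_pos (pow_pos hK.det_pos n) (Real.exp_pos _)

theorem likelihood_eq_sqrt {S : Matrix V V ℝ} (hS : S.PosDef) :
    likelihood x S = (√((2 * Real.pi) ^ Fintype.card V))⁻¹ ^ n *
      √(concentrationLikelihood x S⁻¹) := by
  have hpi : 0 ≤ (2 * Real.pi) ^ Fintype.card V := by positivity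
  have hdet : 0 ≤ S⁻¹.det := hS.inv.det_pos.le
  have hinv : S⁻¹.det = S.det⁻¹ := by rw [det_nonsing_inv, Ring.inverse_eq_inv']
  rw [concentrationLikelihood, Real.sqrt_mul (pow_nonneg hdet n), ← Real.exp_half,
    dataForm, ← Finset.sum_neg_distrib, Finset.sum_div, Real.exp_sum]
  simp only [likelihood, gaussianDensity]
  rw [Finset.prod_mul_distrib, Finset.prod_const, Finset.card_univ, Fintype.card_fin,
    Real.sqrt_mul hpi, mul_inv, mul_pow, mul_assoc, ← Real.sqrt_inv S.det, ← hinv]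
  congr 2
  symm
  rw [Real.sqrt_eq_iff_mul_self_eq (pow_nonneg hdet n) (by positivity), ← mul_pow,
    Real.mul_self_sqrt hdet]

theorem likelihood_le_iff {S T : Matrix V V ℝ} (hS : S.PosDef) (hT : T.PosDef) :
    likelihood x S ≤ likelihood x T ↔
      concentrationLikelihood x S⁻¹ ≤ concentrationLikelihood x T⁻¹ := by
  rw [likelihood_eq_sqrt x hS, likelihood_eq_sqrt x hT, mul_le_mul_iff_right₀ (by positivity),
    Real.sqrt_le_sqrt_iff (concentrationLikelihood_pos x hT.inv).le]

theorem one_mem_concentrationCone (G : SimpleGraph V) :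
    (1 : Matrix V V ℝ) ∈ concentrationCone G :=
  ⟨PosSemidef.one, fun _ _ hij _ => one_apply_ne hij⟩

theorem inv_mem_concentrationCone {G : SimpleGraph V} {S : Matrix V V ℝ} (hS : S ∈ model G) :
    S⁻¹ ∈ concentrationCone G :=
  ⟨hS.1.inv.posSemidef, hS.2⟩

theorem inv_mem_model {G : SimpleGraph V} {K : Matrix V V ℝ} (hK : K.PosDef)
    (hsupp : ∀ i j : V, i ≠ j → ¬ G.Adj i j → K i j = 0) : K⁻¹ ∈ model G := by
  refine ⟨hK.inv, ?_⟩
  rwa [nonsing_inv_nonsing_inv K ((isUnit_iff_isUnit_det K).1 hK.isUnit)]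

open scoped Matrix.Norms.Elementwise in
variable {x} in
/-- If no nonzero element of the cone annihilates the data, then the likelihood tends to zero
at infinity along the cone. -/
theorem eventually_concentrationLikelihood_le {G : SimpleGraph V}
    (h : ∀ K ∈ concentrationCone G, (∀ k, K *ᵥ (x k).ofLp = 0) → K = 0) {ε : ℝ} (hε : 0 < ε) :
    ∀ᶠ K in Filter.cocompact (Matrix V V ℝ) ⊓ Filter.principal (concentrationCone G),
      concentrationLikelihood x K ≤ ε := by
  have hcomp : IsCompact (Metric.sphere (0 : Matrix V V ℝ) 1 ∩ concentrationCone G) :=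
    (isCompact_sphere _ _).inter_right (isClosed_concentrationCone G)
  have hunit : ∀ K ∈ Metric.sphere (0 : Matrix V V ℝ) 1 ∩ concentrationCone G,
      0 < dataForm x K := fun K hK => dataForm_pos h hK.2 fun h0 => by
    simpa [h0] using hK.1
  obtain ⟨c, hc, hcK⟩ : ∃ c > 0, ∀ K ∈ Metric.sphere (0 : Matrix V V ℝ) 1 ∩ concentrationCone G,
      c ≤ dataForm x K :=
    hcomp.exists_forall_le' (continuous_dataForm x).continuousOn hunit
  obtain ⟨M, hM⟩ := hcomp.bddAbove_image (f := fun K => K.det ^ n) (by fun_prop)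
  -- Writing `K = t • L` with `‖L‖ = 1`, the determinant scales by `t ^ card V` and the data form is
  -- at least `c * t`.
  have htend : Filter.Tendsto
      (fun t : ℝ => max M 0 * (t ^ (Fintype.card V * n) * Real.exp (-(c * t))))
      Filter.atTop (nhds 0) := by
    have := tendsto_rpow_mul_exp_neg_mul_atTop_nhds_zero (Fintype.card V * n : ℕ) c hc
    simp only [Real.rpow_natCast, neg_mul] at this
    simpa only [mul_zero] using this.const_mul (max M 0)
  have hev := (tendsto_norm_cocompact_atTop (E := Matrix V V ℝ)).eventually
    ((htend.eventually (ge_mem_nhds hε)).and (Filter.eventually_gt_atTop 0))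
  filter_upwards [Filter.mem_inf_of_left hev,
    Filter.mem_inf_of_right (Filter.mem_principal_self _)] with K hK hKC
  obtain ⟨hle, hpos⟩ := hK
  set t := ‖K‖
  have hmem : t⁻¹ • K ∈ Metric.sphere (0 : Matrix V V ℝ) 1 ∩ concentrationCone G := by
    refine ⟨?_, smul_mem_concentrationCone hKC (by positivity)⟩
    rw [mem_sphere_zero_iff_norm, norm_smul, norm_inv, norm_norm, inv_mul_cancel₀ hpos.ne']
  have hKt : K = t • (t⁻¹ • K) := by rw [smul_smul, mul_inv_cancel₀ hpos.ne', one_smul]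
  generalize t⁻¹ • K = L at hmem hKt
  refine le_trans ?_ hle
  rw [concentrationLikelihood, hKt, det_smul, dataForm_smul, mul_pow, ← pow_mul,
    mul_comm (t ^ _), mul_assoc]
  refine mul_le_mul ((hM ⟨L, hmem, rfl⟩).trans (le_max_left _ _)) ?_ (by positivity)
    (le_max_right _ _)
  rw [mul_comm c]
  gcongr
  exact hcK L hmem

variable {x} in
/-- The MLE exists if no nonzero positive semidefinite matrix supported on the graph annihilates
all observations. -/
theorem mleExists_of_forall_eq_zero {G : SimpleGraph V}
    (h : ∀ K ∈ concentrationCone G, (∀ k, K *ᵥ (x k).ofLp = 0) → K = 0) : MLEExists G x := by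
  -- Without data the likelihood is constant, and `det ^ 0` would not exclude singular maximizers.
  by_cases hn : n = 0
  · subst hn
    have hmem : (1 : Matrix V V ℝ) ∈ model G := by
      simpa using inv_mem_model (G := G) PosDef.one (one_mem_concentrationCone G).2
    exact ⟨1, hmem, fun S _ => by simp [likelihood]⟩
  obtain ⟨K, hK, hmax⟩ := (continuous_concentrationLikelihood x).continuousOn.exists_isMaxOn'
    (isClosed_concentrationCone G) (one_mem_concentrationCone G)
    (eventually_concentrationLikelihood_le h (concentrationLikelihood_pos x PosDef.one))
  have hpos : 0 < concentrationLikelihood x K :=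
    (concentrationLikelihood_pos x PosDef.one).trans_le (hmax (one_mem_concentrationCone G))
  have hdet : K.det ≠ 0 := fun h0 => by
    simp [concentrationLikelihood, h0, hn] at hpos
  have hKpd : K.PosDef :=
    hK.1.posDef_iff_isUnit.2 ((isUnit_iff_isUnit_det K).2 (isUnit_iff_ne_zero.2 hdet))
  refine ⟨K⁻¹, inv_mem_model hKpd hK.2, fun S hS => ?_⟩
  refine (likelihood_le_iff x hS.1 hKpd.inv).2 ?_
  rw [nonsing_inv_nonsing_inv K (isUnit_iff_ne_zero.2 hdet)]
  exact hmax (inv_mem_concentrationCone hS)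

variable {x} in
/-- The MLE does not exist if some nonzero rank one matrix supported on the graph annihilates all
observations. -/
theorem not_mleExists_of_dotProduct_eq_zero {G : SimpleGraph V} (hn : n ≠ 0) {v : V → ℝ}
    (hv : v ≠ 0) (hsupp : ∀ i j, i ≠ j → ¬ G.Adj i j → v i * v j = 0)
    (hx : ∀ k, v ⬝ᵥ (x k).ofLp = 0) : ¬ MLEExists G x := by
  rintro ⟨S, hS, hmax⟩
  have hSdet : IsUnit S.det := (isUnit_iff_isUnit_det S).1 hS.1.isUnit
  have hKdet : IsUnit S⁻¹.det := (isUnit_iff_isUnit_det _).1 hS.1.inv.isUnit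
  set K := S⁻¹ + vecMulVec v v with hKdef
  have hK : K.PosDef := hS.1.inv.add_posSemidef (by simpa using posSemidef_vecMulVec_self_star v)
  have hKS : ∀ i j, i ≠ j → ¬ G.Adj i j → K i j = 0 := fun i j hij hadj => by
    simp [hKdef, hS.2 i j hij hadj, vecMulVec_apply, hsupp i j hij hadj]
  have hdet : S⁻¹.det < K.det := by
    -- Matrix determinant lemma: `det K = det S⁻¹ * (1 + vᵀ S v)`.
    have hpos : 0 < v ⬝ᵥ S *ᵥ v := by simpa using hS.1.dotProduct_mulVec_pos hv
    rw [hKdef, vecMulVec_eq Unit, det_add_replicateCol_mul_replicateRow hKdet,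
      nonsing_inv_nonsing_inv S hSdet, det_unique (n := Unit)]
    refine lt_mul_of_one_lt_right hS.1.inv.det_pos ?_
    rw [Matrix.add_apply, one_apply_eq, Matrix.mul_assoc, ← replicateCol_mulVec]
    simpa [Matrix.mul_apply, dotProduct] using hpos
  have hform : dataForm x K = dataForm x S⁻¹ := by
    simp [dataForm, hKdef, add_mulVec, vecMulVec_mulVec, hx]
  have hle := (likelihood_le_iff x hK.inv hS.1).1 (hmax (inv_mem_model hK hKS))
  rw [nonsing_inv_nonsing_inv K ((isUnit_iff_isUnit_det K).1 hK.isUnit)] at hle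
  refine hle.not_gt ?_
  rw [concentrationLikelihood, concentrationLikelihood, hform]
  have := hS.1.inv.det_pos
  gcongr

end

end GaussianGraphicalModel

/-! ### The two claims for the grid -/

open GaussianGraphicalModel

theorem corollary5p3 :
    (∀ n : ℕ, 3 ≤ n →
      ∀ (Ω : Type*) [MeasurableSpace Ω] (P : MeasureTheory.Measure Ω)
        [MeasureTheory.IsProbabilityMeasure P]
        (S : Matrix (Fin 3 × Fin 3) (Fin 3 × Fin 3) ℝ),
        S ∈ GaussianGraphicalModel.model GaussianGraphicalModel.grid33 →
        ∀ X : Fin n → Ω → EuclideanSpace ℝ (Fin 3 × Fin 3),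
          (∀ k, ProbabilityTheory.HasLaw (X k) (ProbabilityTheory.multivariateGaussian 0 S) P) →
          ProbabilityTheory.iIndepFun X P →
          ∀ᵐ ω ∂P, GaussianGraphicalModel.MLEExists GaussianGraphicalModel.grid33
            (fun k => X k ω)) ∧
    (∀ n : ℕ, 1 ≤ n → n < 2 →
      ∀ x : Fin n → EuclideanSpace ℝ (Fin 3 × Fin 3),
        ¬ GaussianGraphicalModel.MLEExists GaussianGraphicalModel.grid33 x) := by
  constructor
  · intro n hn Ω _ P _ S hS X hX hind
    have hae : ∀ a b c : Fin 3 × Fin 3, ∀ᵐ ω ∂P, a ≠ b → a ≠ c → b ≠ c →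
        coordDet (X ⟨0, by omega⟩ ω) (X ⟨1, by omega⟩ ω) (X ⟨2, by omega⟩ ω) a b c ≠ 0 := by
      intro a b c
      by_cases h : a ≠ b ∧ a ≠ c ∧ b ≠ c
      · filter_upwards [ae_coordDet_ne_zero hS.1 hX hind (i := ⟨0, by omega⟩)
          (j := ⟨1, by omega⟩) (k := ⟨2, by omega⟩) (by simp) (by simp) (by simp)
          h.1 h.2.1 h.2.2] with ω hω _ _ _ using hω
      · exact Filter.Eventually.of_forall fun ω h1 h2 h3 => absurd ⟨h1, h2, h3⟩ h
    have hall := MeasureTheory.ae_all_iff.2 fun a => MeasureTheory.ae_all_iff.2 fun b =>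
      MeasureTheory.ae_all_iff.2 (hae a b)
    filter_upwards [hall] with ω hω
    exact mleExists_of_forall_eq_zero fun K hK hx =>
      eq_zero_of_mulVec_eq_zero (by simpa using hK.1.isHermitian) hK.2 hω (hx _) (hx _) (hx _)
  · intro n h1 h2 x
    obtain rfl : n = 1 := by omega
    -- The edge vector used in the second case could be zero if this coordinate vanished; then a
    -- basis vector does the job.
    by_cases h0 : (x 0).ofLp (0, 0) = 0
    · refine not_mleExists_of_dotProduct_eq_zero one_ne_zero (v := Pi.single (0, 0) 1) (by simp)
        (fun i j hij _ => ?_) fun k => ?_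
      · by_cases hi : i = (0, 0)
        · simp [Pi.single_apply, show j ≠ (0, 0) from fun h => hij (hi.trans h.symm)]
        · simp [Pi.single_apply, hi]
      · rw [Subsingleton.elim k 0]
        simp [h0]
    · refine not_mleExists_of_dotProduct_eq_zero one_ne_zero
        (v := Pi.single (0, 1) ((x 0).ofLp (0, 0)) - Pi.single (0, 0) ((x 0).ofLp (0, 1)))
        (fun h => h0 ?_) (fun i j hij hadj => ?_) fun k => ?_
      · simpa [Pi.single_apply] using congrFun h (0, 1)
      · by_contra hne
        have hmem : ∀ v, (Pi.single (0, 1) ((x 0).ofLp (0, 0)) -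
            Pi.single (0, 0) ((x 0).ofLp (0, 1)) : Fin 3 × Fin 3 → ℝ) v ≠ 0 →
            v = (0, 1) ∨ v = (0, 0) := by
          intro v hv
          by_contra! h
          exact hv (by simp [h])
        rcases hmem i (left_ne_zero_of_mul hne) with rfl | rfl <;>
          rcases hmem j (right_ne_zero_of_mul hne) with rfl | rfl
        exacts [hij rfl, hadj (by decide), hadj (by decide), hij rfl]
      · rw [Subsingleton.elim k 0]
        simp [sub_dotProduct, mul_comm]
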